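/- Let $n\ge 1$ be an integer, $d\in(0,1)$, and let $T=T_{n+d}$ be a triangle in the plane with a selected side of length $n+d$. A homothetic unit triangle is an image of $T$ under a homothety (of positive ratio: an up-triangle; of negative ratio: a down-triangle) whose corresponding side has length $1$. View the selected side as the horizontal base of $T$; lengths along any side of $T$ are measured in units of that side of a homothetic unit triangle. A row with $a$ up-triangles and $b$ down-triangles consists of alternating up- and down-triangles with the bases of the up-triangles on one horizontal line, the first up-triangle lying at the left side of the covering. An up-left slide with slide value $s$ moves each down-triangle by $s$ up and to the left along the right leg of the preceding up-triangle, and a down-right slide moves it by $s$ in the opposite direction; the following triangles of the row are moved horizontally so that they stay in contact. The rows are stacked along the left side of $T$ without gaps, numbered $1,2,\dots$ from the top, the last one standing on the base of $T$. Even method: let $j_{even}=\lfloor(1-d)(n+1)\rfloor$ and $p_{even}=n-j_{even}+1$. For $k<j_{even}$, row $k$ has $k$ up- and $k-1$ down-triangles and is not slid; for $j_{even}\le k\le n$, row $k$ has $k+1$ up- and $k$ down-triangles and is slid up-left with slide value $\frac{j_{even}}{k(k+1)}$. (If $j_{even}=0$, the standard covering of $T_{n+1}$ by $(n+1)^2$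 triangles is used instead.) Odd method: let $j_{odd}=\lceil dn+1\rceil$ and $p_{odd}=j_{odd}-1$. Row $1$ is the standard covering of a $T_2$ by $4$ triangles; for $2\le k<j_{odd}$, $k\le n$, row $k$ has $k+1$ up- and $k$ down-triangles and is not slid; for $j_{odd}\le k\le n$, row $k$ has $k$ up- and $k-1$ down-triangles and is slid down-right with slide value $\frac{j_{odd}-1}{k(k-1)}$. The consolidated method uses the odd method if $p_{odd}<p_{even}$, and the even method otherwise. Theorem. For all such $n$, $d$ and $T$, the unit triangles placed by the consolidated method are homothetic to $T$ and cover $T$. Their number is $n^2+2p_{odd}+1$ if $p_{odd}<p_{even}$ and $n^2+2p_{even}$ otherwise, and this is the minimum possible: $T$ cannot be covered by fewer homothetic unit triangles. -/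

import Mathlib

noncomputable section

namespace TriangleCover

/-- The Euclidean plane. -/
abbrev Plane : Type := EuclideanSpace ℝ (Fin 2)

/-- The closed solid triangle with the given vertices. -/
def solid (T : Affine.Triangle ℝ Plane) : Set Plane :=
  convexHull ℝ (Set.range T.points)

/-- The length of the selected side of `T`, which is the one joining vertices `0` and `1`. -/
def sideLength (T : Affine.Triangle ℝ Plane) : ℝ :=
  dist (T.points 0) (T.points 1)

/-- `S` is a unit triangle homothetic to `T`: the image of `T` under a homothety (of positive ratio
for an up-triangle, of negative ratio for a down-triangle) that gives the selected side length 1. -/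
def IsHomotheticUnit (T : Affine.Triangle ℝ Plane) (S : Set Plane) : Prop :=
  ∃ (c : Plane) (r : ℝ),
    S = AffineMap.homothety c r '' solid T ∧
    dist (AffineMap.homothety c r (T.points 0)) (AffineMap.homothety c r (T.points 1)) = 1

/-- The point with skew coordinates `(x, y)`: the origin is vertex `0`, the first axis runs along
the selected side and the second one along the side from vertex `0` to vertex `2`, both scaled so
that the triangle `(0,0), (1,0), (0,1)` is a unit triangle. In these coordinates `T` is
`0 ≤ x, 0 ≤ y, x + y ≤ sideLength T`. -/
def pt (T : Affine.Triangle ℝ Plane) (x y : ℝ) : Plane :=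
  T.points 0 + (x / sideLength T) • (T.points 1 - T.points 0)
    + (y / sideLength T) • (T.points 2 - T.points 0)

/-- A placed unit triangle, in skew coordinates: an up-triangle is given by the left end of its
base, a down-triangle by its nadir. -/
inductive Tile : Type
  | up (x y : ℝ) : Tile
  | down (x y : ℝ) : Tile

/-- The closed region that a placed unit triangle occupies. -/
def Tile.region (T : Affine.Triangle ℝ Plane) : Tile → Set Plane
  | .up x y => convexHull ℝ {pt T x y, pt T (x + 1) y, pt T x (y + 1)}
  | .down x y => convexHull ℝ {pt T x y, pt T x (y + 1), pt T (x - 1) (y + 1)}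

/-- A trapezoidal row of `a` up-triangles with bases at height `y`, and `b` down-triangles, that
alternate from the left side on. For `s ≥ 0` the up-left slide operation with slide value `s` has
been performed: each down-triangle is moved by `s` up and to the left along the right leg of the
preceding up-triangle, and the following unit triangles are moved left so as to keep contact.
For `s ≤ 0` it is the down-right slide operation with slide value `-s`. -/
def row (a b : ℕ) (s y : ℝ) : List Tile :=
  (List.range a).map (fun i : ℕ => Tile.up ((i : ℝ) * (1 - s)) y) ++
    (List.range b).map (fun i : ℕ => Tile.down (((i : ℝ) + 1) * (1 - s)) (y + s))

/-- The standard covering of a triangle of side length `m` by `m ^ 2` unit triangles. -/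
def naive (m : ℕ) : List Tile :=
  (List.range' 1 m).flatMap fun k : ℕ => row k (k - 1) 0 ((m : ℝ) - k)

/-- The slide value of row `k` in the even method that starts to slide on row `j`. -/
def evenSlide (j k : ℕ) : ℝ :=
  if j ≤ k then (j : ℝ) / ((k : ℝ) * ((k : ℝ) + 1)) else 0

/-- The distance, measured along the left side, from the apex of the covering to the base line of
row `k` in the even method: every row `i` contributes `1 + evenSlide j i`. -/
def evenDepth (j k : ℕ) : ℝ :=
  (k : ℝ) + ∑ i ∈ Finset.Icc j k, evenSlide j i

/-- The basic even method: rows `1, …, j - 1` are as in the standard covering; each row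
`k = j, …, n` receives an extra down-triangle and up-triangle and is slid up-left. The bottom row
is placed along the base and the left side. -/
def basicEven (n j : ℕ) : List Tile :=
  (List.range' 1 n).flatMap fun k : ℕ =>
    if j ≤ k then row (k + 1) k (evenSlide j k) (evenDepth j n - evenDepth j k)
    else row k (k - 1) 0 (evenDepth j n - evenDepth j k)

/-- The (down-right) slide value of row `k` in the odd method that starts to slide on row `j`. -/
def oddSlide (j k : ℕ) : ℝ :=
  if j ≤ k then ((j : ℝ) - 1) / ((k : ℝ) * ((k : ℝ) - 1)) else 0

/-- The distance, measured along the left side, from the apex of the covering to the base line of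
row `k` in the odd method: row 1 has side length 2, and every other row `i` contributes
`1 - oddSlide j i`. -/
def oddDepth (j k : ℕ) : ℝ :=
  (k : ℝ) + 1 - ∑ i ∈ Finset.Icc j k, oddSlide j i

/-- The basic odd method (for `2 ≤ j`): row 1 is the standard covering of a triangle of side
length 2 (it has 3 extra unit triangles); each row `k = 2, …, j - 1` receives an extra
down-triangle and up-triangle; each row `k = j, …, n` receives no extra triangle and is slid
down-right. The first element of the list is the top triangle of row 1, and the rest of row 1 is
the case `k = 1` of the rows below. -/
def basicOdd (n j : ℕ) : List Tile :=
  Tile.up 0 (oddDepth j n - 1) ::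
    (List.range' 1 n).flatMap fun k : ℕ =>
      if j ≤ k then row k (k - 1) (-oddSlide j k) (oddDepth j n - oddDepth j k)
      else row (k + 1) k 0 (oddDepth j n - oddDepth j k)

/-- The first row that the even method slides. -/
def jEven (n : ℕ) (d : ℝ) : ℕ := ⌊(1 - d) * ((n : ℝ) + 1)⌋₊

/-- The first row that the odd method slides. -/
def jOdd (n : ℕ) (d : ℝ) : ℕ := ⌈d * (n : ℝ) + 1⌉₊

/-- The number of extra pairs in the even method (`jEven n d ≤ n` for `0 < d`). -/
def pEven (n : ℕ) (d : ℝ) : ℕ := n - jEven n d + 1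

/-- The number of extra pairs, besides one extra triangle, in the odd method
(`1 ≤ jOdd n d` for `0 ≤ d`). -/
def pOdd (n : ℕ) (d : ℝ) : ℕ := jOdd n d - 1

/-- The full even method, which reverts to the standard covering of a triangle of side length
`n + 1` when there is no row to start with. -/
def fullEven (n : ℕ) (d : ℝ) : List Tile :=
  if jEven n d = 0 then naive (n + 1) else basicEven n (jEven n d)

/-- The full odd method. For `jOdd n d = n + 1` no row is slid, and this is the standard covering
of a triangle of side length `n + 1`. -/
def fullOdd (n : ℕ) (d : ℝ) : List Tile := basicOdd n (jOdd n d)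

/-- The consolidated method, in skew coordinates. -/
def fullTiles (n : ℕ) (d : ℝ) : List Tile :=
  if pOdd n d < pEven n d then fullOdd n d else fullEven n d

/-- The consolidated method: the list of the unit triangles that it places in order to cover a
triangle `T` whose selected side has length `n + d`. -/
def coverTriangleFull (n : ℕ) (d : ℝ) (T : Affine.Triangle ℝ Plane) : List (Set Plane) :=
  (fullTiles n d).map (Tile.region T)

end TriangleCover

end

/-!
The proof works in skew coordinates, in which `T` is `0 ≤ x`, `0 ≤ y`, `x + y ≤ n + d` and a
homothetic unit triangle is a `Tile` (`isHomotheticUnit_iff`).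

*The method covers `T`.* A row with slide value `s` covers a trapezoid of height `1 + s` whose base
has length `1 + b * (1 - s)`, for `b` down-triangles (`covers_row`). The slide values telescope
(`evenDepth_of_le`, `oddDepth_of_le`), so that the base of each trapezoid is as long as the
section of the covered triangle there; the whole has side length `n + 1 - j / (n + 1)` in the even
method and `n + (j - 1) / n` in the odd one, and `j` is chosen to make that at least `n + d`.

*No covering has fewer triangles.* For `t ∈ [0, 1)` let `G t` be the total length of the sections
of all triangles of a covering by the horizontal lines at the heights congruent to `t` modulo `1`,
and let `F t` be that of the sections of `T`. Then `G ≥ F`, the integral of `G` over a period is half the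
number `N` of triangles, and the integral of `F` is `(n + d) ^ 2 / 2`. This is the area bound. It
improves because `G` is known modulo `1`: its slope is minus the excess of the number of up- over
the number of down-triangles, and its jumps are integers. Hence, modulo `1`, the difference `G - F`
is a continuous function of slope `s + 1` on `[0, d]` and slope `s` on `[d, 1]`, where `s` is an
integer with the parity of `n - N`. Being nonnegative, it is at least its fractional part
(`exists_bentFract_le`).

A primitive of the fractional part is `v / 2 - hump v`, where `hump` is periodic and the maximum of
the parabolas `(v - k) * (k + 1 - v) / 2`. Jensen's identity for the parabola that touches `hump`
at the middle one of three points bounds the integral of the fractional part from below, uniformly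
in `s` (`le_bentFract`; the slopes `0` and `-1` are treated separately). The result is
`N ≥ n ^ 2 + 2 * (n + 1) * d` if `N` has the parity of `n`, and `N ≥ n ^ 2 + 2 * n * d + 1`
otherwise (`card_ge`), which round up to the numbers of triangles of the even and of the odd method.
-/

noncomputable section

namespace TriangleCover

open MeasureTheory

/-! ### Integrals of fractional parts along affine functions -/

/-- The periodic hump `{v} (1 - {v}) / 2`. Up to sign it is the periodic part of a primitive of
the fractional part, see `integral_fract`. -/
def hump (v : ℝ) : ℝ := Int.fract v * (1 - Int.fract v) / 2

lemma hump_add_int (v : ℝ) (k : ℤ) : hump (v + k) = hump v := by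
  simp [hump]

lemma continuous_hump : Continuous hump := by
  exact ContinuousOn.comp_fract'' (f := fun x : ℝ => x * (1 - x) / 2) (by fun_prop) (by norm_num)

/-- The hump is the maximum of the parabolas through consecutive integers. -/
lemma parabola_le_hump (v : ℝ) (k : ℤ) : (v - k) * (k + 1 - v) / 2 ≤ hump v := by
  have h0 := Int.fract_nonneg v
  have h1 := (Int.fract_lt_one v).le
  have hv : v = ⌊v⌋ + Int.fract v := (Int.floor_add_fract v).symm
  unfold hump
  obtain ⟨j, hj⟩ : ∃ j : ℤ, ⌊v⌋ = k + j := ⟨⌊v⌋ - k, by ring⟩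
  rw [hj] at hv
  push_cast at hv
  generalize Int.fract v = f at *
  subst hv
  have key : 0 ≤ (j : ℝ) * (j - 1 + 2 * f) := by
    rcases lt_trichotomy j 0 with h | h | h
    · have : (j : ℝ) ≤ -1 := by exact_mod_cast Int.le_sub_one_of_lt h
      nlinarith
    · simp [h]
    · have : (1 : ℝ) ≤ j := by exact_mod_cast h
      apply mul_nonneg <;> linarith
  nlinarith

lemma hump_eq_parabola (v : ℝ) : hump v = (v - ⌊v⌋) * (⌊v⌋ + 1 - v) / 2 := by
  unfold hump
  rw [← Int.self_sub_floor]
  ring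

/-- The hump fails to be convex at most by as much as the parabola `-v ^ 2 / 2`: this is Jensen's
identity for the parabola that touches the hump at the intermediate point. -/
lemma hump_jensen {m : ℝ} (hm : 0 ≤ m) (θ δ : ℝ) :
    (m + 1) * hump (θ - m * δ) ≤
      m * hump (θ - (m + 1) * δ) + hump θ + m * (m + 1) * δ ^ 2 / 2 := by
  rw [hump_eq_parabola (θ - m * δ)]
  have h1 := mul_le_mul_of_nonneg_left
    (parabola_le_hump (θ - (m + 1) * δ) ⌊θ - m * δ⌋) hm
  have h2 := parabola_le_hump θ ⌊θ - m * δ⌋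
  nlinarith

lemma intervalIntegrable_fract_comp {g : ℝ → ℝ} (hg : Measurable g) (u v : ℝ) :
    IntervalIntegrable (fun t => Int.fract (g t)) volume u v := by
  refine (intervalIntegrable_const (c := (1 : ℝ))).mono_fun
    (measurable_fract.comp hg).aestronglyMeasurable (Filter.Eventually.of_forall fun t => ?_)
  simp only [Real.norm_eq_abs, abs_one]
  rw [abs_of_nonneg (Int.fract_nonneg _)]
  exact (Int.fract_lt_one _).le

lemma integral_fract (u v : ℝ) :
    ∫ t in u..v, Int.fract t = (v / 2 - hump v) - (u / 2 - hump u) := by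
  refine intervalIntegral.integral_eq_sub_of_hasDeriv_right
    (f := fun t => t / 2 - hump t) (by have := continuous_hump; fun_prop) (fun x _ => ?_)
    (intervalIntegrable_fract_comp measurable_id u v)
  have hd : HasDerivAt (fun t : ℝ => t / 2 - (t - ⌊x⌋) * (⌊x⌋ + 1 - t) / 2) (Int.fract x) x := by
    have h1 := (hasDerivAt_id x).div_const 2
    have h2 := (((hasDerivAt_id x).sub_const (⌊x⌋ : ℝ)).mul
      ((hasDerivAt_id x).const_sub ((⌊x⌋ : ℝ) + 1))).div_const 2
    refine (h1.sub h2).congr_deriv ?_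
    rw [← Int.self_sub_floor]
    simp only [id]
    ring
  refine hd.hasDerivWithinAt.congr_of_eventuallyEq ?_ (by rw [hump_eq_parabola])
  have : Set.Ioo x (⌊x⌋ + 1) ∈ nhdsWithin x (Set.Ioi x) :=
    Ioo_mem_nhdsGT (Int.lt_floor_add_one x)
  filter_upwards [this] with t ht
  have hf : ⌊t⌋ = ⌊x⌋ :=
    Int.floor_eq_iff.2 ⟨(Int.floor_le x).trans ht.1.le, ht.2⟩
  rw [hump_eq_parabola, hf]

lemma mul_integral_fract_affine (m θ d u v : ℝ) :
    m * ∫ t in u..v, Int.fract (θ + m * (t - d)) =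
      ((θ + m * (v - d)) / 2 - hump (θ + m * (v - d))) -
        ((θ + m * (u - d)) / 2 - hump (θ + m * (u - d))) := by
  rw [← integral_fract, show θ + m * (v - d) = m * v + (θ - m * d) by ring,
    show θ + m * (u - d) = m * u + (θ - m * d) by ring,
    ← intervalIntegral.mul_integral_comp_mul_add]
  congr 2
  ext t
  ring_nf

/-- The integral over a period of the fractional part of a function that has slope `s + 1` up to
the point `d`, and slope `s` from there on. -/
def bentFract (s θ d : ℝ) : ℝ :=
  (∫ t in (0 : ℝ)..d, Int.fract (θ + (s + 1) * (t - d))) +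
    ∫ t in d..1, Int.fract (θ + s * (t - d))

lemma le_bentFract_zero (θ d : ℝ) : d - d ^ 2 / 2 ≤ bentFract 0 θ d := by
  have h1 := mul_integral_fract_affine 1 θ d 0 d
  -- the parabola to the left of `θ` is the one for which the estimate is sharp
  have h2 := parabola_le_hump (θ - d) (⌊θ⌋ - 1)
  have h3 : hump θ = Int.fract θ * (1 - Int.fract θ) / 2 := rfl
  have h4 := Int.floor_add_fract θ
  simp only [one_mul, sub_self, add_zero, zero_sub, ← sub_eq_add_neg] at h1
  simp only [bentFract, zero_add, one_mul, zero_mul, add_zero, intervalIntegral.integral_const,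
    smul_eq_mul]
  rw [h1, h3]
  push_cast at h2
  rw [show θ - d - ((⌊θ⌋ : ℝ) - 1) = Int.fract θ - d + 1 by linarith,
    show (⌊θ⌋ : ℝ) - 1 + 1 - (θ - d) = d - Int.fract θ by linarith] at h2
  nlinarith

lemma le_bentFract_neg_one (θ d : ℝ) : (1 - d ^ 2) / 2 ≤ bentFract (-1) θ d := by
  have h1 := mul_integral_fract_affine (-1) θ d d 1
  have h2 := parabola_le_hump (θ - (1 - d)) (⌊θ⌋ - 1)
  have h3 : hump θ = Int.fract θ * (1 - Int.fract θ) / 2 := rfl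
  have h4 := Int.floor_add_fract θ
  simp only [sub_self, mul_zero, add_zero, neg_mul, one_mul, ← sub_eq_add_neg] at h1
  simp only [bentFract, neg_add_cancel, zero_mul, add_zero, intervalIntegral.integral_const,
    smul_eq_mul, sub_zero, neg_mul, one_mul, ← sub_eq_add_neg]
  rw [h3] at h1
  push_cast at h2
  rw [show θ - (1 - d) - ((⌊θ⌋ : ℝ) - 1) = Int.fract θ + d by linarith,
    show (⌊θ⌋ : ℝ) - 1 + 1 - (θ - (1 - d)) = 1 - d - Int.fract θ by linarith] at h2
  nlinarith

/-- Apart from the slopes treated in `le_bentFract_zero` and `le_bentFract_neg_one`, the estimate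
holds with every `δ` congruent to `d` modulo `1`, as the hump is periodic. -/
lemma le_bentFract {s : ℤ} (h0 : s ≠ 0) (h1 : s ≠ -1) (θ d : ℝ) (k : ℤ) :
    (1 - (d - k) ^ 2) / 2 ≤ bentFract s θ d := by
  have e1 := mul_integral_fract_affine (s + 1 : ℝ) θ d 0 d
  have e2 := mul_integral_fract_affine (s : ℝ) θ d d 1
  have e3 : hump (θ + (s + 1) * (0 - d)) = hump (θ - (s + 1) * (d - k)) := by
    rw [← hump_add_int _ ((s + 1) * k)]
    push_cast
    ring_nf
  have e4 : hump (θ + s * (1 - d)) = hump (θ - s * (d - k)) := by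
    rw [← hump_add_int _ (s * (k - 1))]
    push_cast
    ring_nf
  rw [e3] at e1
  rw [e4] at e2
  simp only [sub_self, mul_zero, add_zero] at e1 e2
  unfold bentFract
  set I := ∫ t in (0 : ℝ)..d, Int.fract (θ + (s + 1) * (t - d))
  set J := ∫ t in d..1, Int.fract (θ + s * (t - d))
  have hs : (0 : ℝ) < s * (s + 1) := by
    have : 0 < s * (s + 1) := by
      rcases lt_or_gt_of_ne h0 with h | h
      · have : s ≤ -2 := by omega
        nlinarith
      · positivity
    exact_mod_cast this
  have key : (s + 1) * hump (θ - s * (d - k)) ≤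
      s * hump (θ - (s + 1) * (d - k)) + hump θ + s * (s + 1) * (d - k) ^ 2 / 2 := by
    rcases lt_or_gt_of_ne h0 with h | h
    · -- for negative `s` the two humps on the left and right trade places
      have hs' : (0 : ℝ) ≤ -s - 1 := by
        have : 0 ≤ -s - 1 := by omega
        exact_mod_cast this
      have := hump_jensen hs' θ (-(d - k))
      rw [show θ - (-(s : ℝ) - 1) * -(d - k) = θ - (s + 1) * (d - k) by ring,
        show θ - (-(s : ℝ) - 1 + 1) * -(d - k) = θ - s * (d - k) by ring] at this
      linarith
    · exact hump_jensen (by exact_mod_cast h.le) θ (d - k)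
  have : s * (s + 1) * ((1 - (d - k) ^ 2) / 2) ≤ s * (s + 1) * (I + J) := by
    have e5 : s * (s + 1) * (I + J) = s * ((s + 1) * I) + (s + 1) * (s * J) := by ring
    rw [e5, e1, e2]
    linarith
  exact le_of_mul_le_mul_left this hs

/-! ### Skew coordinates -/

lemma sub_pt (T : Affine.Triangle ℝ Plane) (x y : ℝ) :
    pt T x y - T.points 0 = (x / sideLength T) • (T.points 1 - T.points 0)
      + (y / sideLength T) • (T.points 2 - T.points 0) := by
  simp only [pt]
  abel

lemma linearIndependent_sides (T : Affine.Triangle ℝ Plane) :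
    LinearIndependent ℝ ![T.points 1 - T.points 0, T.points 2 - T.points 0] := by
  have h := (affineIndependent_iff_linearIndependent_vsub ℝ T.points 0).1 T.independent
  have h2 := h.comp ![⟨1, by decide⟩, ⟨2, by decide⟩] (by
    intro i j; fin_cases i <;> fin_cases j <;> simp)
  have h3 : (fun i : {x // x ≠ (0 : Fin 3)} => (T.points i -ᵥ T.points 0 : Plane)) ∘
      ![⟨1, by decide⟩, ⟨2, by decide⟩] = ![T.points 1 - T.points 0, T.points 2 - T.points 0] := by
    ext i : 1
    fin_cases i <;> rfl
  rwa [h3] at h2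

lemma sideLength_pos (T : Affine.Triangle ℝ Plane) : 0 < sideLength T :=
  dist_pos.2 (T.independent.injective.ne (by decide))

lemma pt_injective {T : Affine.Triangle ℝ Plane} {x y x' y' : ℝ} (h : pt T x y = pt T x' y') :
    x = x' ∧ y = y' := by
  have hL := (sideLength_pos T).ne'
  have h1 := LinearIndependent.pair_iff.1 (linearIndependent_sides T)
    (x / sideLength T - x' / sideLength T) (y / sideLength T - y' / sideLength T) (by
      have h2 := sub_pt T x y
      rw [h, sub_pt] at h2
      rw [sub_smul, sub_smul, ← sub_eq_zero.2 h2.symm]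
      abel)
  refine ⟨?_, ?_⟩
  · simpa [sub_eq_zero, div_left_inj' hL] using h1.1
  · simpa [sub_eq_zero, div_left_inj' hL] using h1.2

lemma exists_eq_pt (T : Affine.Triangle ℝ Plane) (p : Plane) : ∃ x y, p = pt T x y := by
  have hspan := (linearIndependent_sides T).span_eq_top_of_card_eq_finrank' (by simp)
  have hp : p - T.points 0 ∈ Submodule.span ℝ
      (Set.range ![T.points 1 - T.points 0, T.points 2 - T.points 0]) := by
    rw [hspan]; trivial
  rw [Matrix.range_cons, Matrix.range_cons, Matrix.range_empty, Set.union_empty,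
    Set.singleton_union, Submodule.mem_span_pair] at hp
  obtain ⟨a, b, hab⟩ := hp
  have hL := (sideLength_pos T).ne'
  refine ⟨a * sideLength T, b * sideLength T, ?_⟩
  rw [← sub_left_inj (a := T.points 0), sub_pt, mul_div_cancel_right₀ _ hL,
    mul_div_cancel_right₀ _ hL, hab]

lemma homothety_pt (T : Affine.Triangle ℝ Plane) (r u v x y : ℝ) :
    AffineMap.homothety (pt T u v) r (pt T x y) = pt T (u + r * (x - u)) (v + r * (y - v)) := by
  simp only [AffineMap.homothety_apply, pt, vsub_eq_sub, vadd_eq_add]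
  module

/-- The triangle with a vertex `(x, y)` and sides of the signed length `l` along the axes. -/
lemma convexHull_pt (T : Affine.Triangle ℝ Plane) (l x y : ℝ) :
    convexHull ℝ {pt T x y, pt T (x + l) y, pt T x (y + l)} =
      {p | ∃ μ ν, p = pt T (x + μ * l) (y + ν * l) ∧ 0 ≤ μ ∧ 0 ≤ ν ∧ μ + ν ≤ 1} := by
  rw [convexHull_insert (by simp), convexHull_pair]
  ext p
  simp only [mem_convexJoin, Set.mem_singleton_iff, segment_eq_image, Set.mem_image, Set.mem_Icc,
    exists_exists_and_eq_and, exists_eq_left, Set.mem_ofPred_eq]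
  constructor
  · rintro ⟨a, ⟨ha0, ha1⟩, b, ⟨hb0, hb1⟩, rfl⟩
    refine ⟨b * (1 - a), b * a, ?_, mul_nonneg hb0 (by linarith), mul_nonneg hb0 ha0, by linarith⟩
    simp only [pt]
    module
  · rintro ⟨μ, ν, rfl, hμ, hν, h⟩
    rcases (add_nonneg hμ hν).eq_or_lt with h0 | h0
    · refine ⟨0, by simp, 0, by simp, ?_⟩
      obtain rfl : μ = 0 := by linarith
      obtain rfl : ν = 0 := by linarith
      simp
    · refine ⟨ν / (μ + ν), ⟨by positivity, (div_le_one h0).2 (by linarith)⟩, μ + ν,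
        ⟨h0.le, h⟩, ?_⟩
      have e : ν = (μ + ν) * (ν / (μ + ν)) := by field_simp
      generalize ν / (μ + ν) = c at *
      simp only [pt]
      have e1 : μ = (μ + ν) * (1 - c) := by linarith
      generalize μ + ν = w at *
      subst e e1
      module

lemma mem_convexHull_up (T : Affine.Triangle ℝ Plane) {l : ℝ} (hl : 0 < l) (x y a b : ℝ) :
    pt T a b ∈ convexHull ℝ {pt T x y, pt T (x + l) y, pt T x (y + l)} ↔
      x ≤ a ∧ y ≤ b ∧ a + b ≤ x + y + l := by
  rw [convexHull_pt, Set.mem_ofPred_eq]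
  constructor
  · rintro ⟨μ, ν, h, hμ, hν, hs⟩
    obtain ⟨rfl, rfl⟩ := pt_injective h
    refine ⟨by nlinarith, by nlinarith, by nlinarith⟩
  · rintro ⟨h1, h2, h3⟩
    refine ⟨(a - x) / l, (b - y) / l, ?_, div_nonneg (by linarith) hl.le,
      div_nonneg (by linarith) hl.le, ?_⟩
    · rw [div_mul_cancel₀ _ hl.ne', div_mul_cancel₀ _ hl.ne']
      congr 1 <;> ring
    · rw [← add_div, div_le_one hl]
      linarith

lemma mem_region_up (T : Affine.Triangle ℝ Plane) (x y a b : ℝ) :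
    pt T a b ∈ (Tile.up x y).region T ↔ x ≤ a ∧ y ≤ b ∧ a + b ≤ x + y + 1 :=
  mem_convexHull_up T one_pos x y a b

lemma mem_region_down (T : Affine.Triangle ℝ Plane) (x y a b : ℝ) :
    pt T a b ∈ (Tile.down x y).region T ↔ a ≤ x ∧ b ≤ y + 1 ∧ x + y ≤ a + b := by
  have h := convexHull_pt T (-1) x (y + 1)
  rw [← sub_eq_add_neg, add_assoc, add_neg_cancel, add_zero] at h
  rw [Tile.region, show ({pt T x y, pt T x (y + 1), pt T (x - 1) (y + 1)} : Set Plane) =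
    {pt T x (y + 1), pt T (x - 1) (y + 1), pt T x y} by
      rw [Set.insert_comm, Set.pair_comm (pt T x y)], h, Set.mem_ofPred_eq]
  constructor
  · rintro ⟨μ, ν, h, hμ, hν, hs⟩
    obtain ⟨rfl, rfl⟩ := pt_injective h
    refine ⟨by linarith, by linarith, by linarith⟩
  · rintro ⟨h1, h2, h3⟩
    refine ⟨x - a, y + 1 - b, ?_, by linarith, by linarith, by linarith⟩
    congr 1 <;> ring

lemma solid_eq (T : Affine.Triangle ℝ Plane) :
    solid T = convexHull ℝ {pt T 0 0, pt T (sideLength T) 0, pt T 0 (sideLength T)} := by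
  have hL := (sideLength_pos T).ne'
  rw [solid]
  congr 1
  ext p
  simp [Fin.exists_fin_succ, pt, hL, eq_comm]

lemma mem_solid (T : Affine.Triangle ℝ Plane) (a b : ℝ) :
    pt T a b ∈ solid T ↔ 0 ≤ a ∧ 0 ≤ b ∧ a + b ≤ sideLength T := by
  rw [solid_eq]
  have h := mem_convexHull_up T (sideLength_pos T) 0 0 a b
  simpa only [zero_add] using h

lemma homothety_image_solid (T : Affine.Triangle ℝ Plane) (r u v : ℝ) :
    AffineMap.homothety (pt T u v) r '' solid T =
      convexHull ℝ {pt T (u - r * u) (v - r * v),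
        pt T (u - r * u + r * sideLength T) (v - r * v),
        pt T (u - r * u) (v - r * v + r * sideLength T)} := by
  rw [solid_eq, AffineMap.image_convexHull, Set.image_insert_eq, Set.image_pair]
  simp only [homothety_pt]
  ring_nf

lemma region_up_eq (T : Affine.Triangle ℝ Plane) (u v : ℝ) :
    AffineMap.homothety (pt T u v) (1 / sideLength T) '' solid T =
      (Tile.up (u - 1 / sideLength T * u) (v - 1 / sideLength T * v)).region T := by
  rw [homothety_image_solid, one_div_mul_cancel (sideLength_pos T).ne']
  rfl

lemma region_down_eq (T : Affine.Triangle ℝ Plane) (u v : ℝ) :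
    AffineMap.homothety (pt T u v) (-(1 / sideLength T)) '' solid T =
      (Tile.down (u + 1 / sideLength T * u) (v + 1 / sideLength T * v - 1)).region T := by
  rw [homothety_image_solid, neg_mul, neg_mul, neg_mul,
    one_div_mul_cancel (sideLength_pos T).ne', Tile.region, Set.insert_comm,
    Set.pair_comm, Set.insert_comm, Set.pair_comm]
  simp only [sub_neg_eq_add, ← sub_eq_add_neg, sub_add_cancel]

lemma dist_homothety (T : Affine.Triangle ℝ Plane) (c : Plane) (r : ℝ) :
    dist (AffineMap.homothety c r (T.points 0)) (AffineMap.homothety c r (T.points 1)) =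
      |r| * sideLength T := by
  simp only [AffineMap.homothety_apply, vsub_eq_sub, vadd_eq_add, dist_add_right, dist_smul₀,
    dist_sub_right, Real.norm_eq_abs, sideLength]

/-- The homothetic unit triangles are exactly the regions of tiles; a side length other than `1` is
needed so that the homotheties of ratio `1 / sideLength T` include all positions. -/
lemma isHomotheticUnit_iff {T : Affine.Triangle ℝ Plane} (hT : 1 < sideLength T)
    (S : Set Plane) : IsHomotheticUnit T S ↔ ∃ τ : Tile, S = τ.region T := by
  have hL := sideLength_pos T
  constructor
  · rintro ⟨c, r, rfl, hr⟩
    rw [dist_homothety] at hr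
    obtain ⟨u, v, rfl⟩ := exists_eq_pt T c
    have hr' : |r| = 1 / sideLength T := by field_simp; exact hr
    rcases eq_or_eq_neg_of_abs_eq hr' with h | h
    · exact ⟨_, by rw [h, region_up_eq]⟩
    · exact ⟨_, by rw [h, region_down_eq]⟩
  · have h1 : 1 - 1 / sideLength T ≠ 0 := by
      rw [one_div]; exact (sub_pos.2 (inv_lt_one_of_one_lt₀ hT)).ne'
    have h2 : 1 + 1 / sideLength T ≠ 0 := by positivity
    have e1 (x : ℝ) : x / (1 - 1 / sideLength T) - 1 / sideLength T *
        (x / (1 - 1 / sideLength T)) = x := by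
      rw [← one_sub_mul, mul_div_cancel₀ _ h1]
    have e2 (x : ℝ) : x / (1 + 1 / sideLength T) + 1 / sideLength T *
        (x / (1 + 1 / sideLength T)) = x := by
      rw [← one_add_mul, mul_div_cancel₀ _ h2]
    rintro ⟨⟨x, y⟩ | ⟨x, y⟩, rfl⟩
    · refine ⟨pt T (x / (1 - 1 / sideLength T)) (y / (1 - 1 / sideLength T)),
        1 / sideLength T, ?_, ?_⟩
      · rw [region_up_eq, e1, e1]
      · rw [dist_homothety, abs_of_pos (by positivity), one_div_mul_cancel hL.ne']
    · refine ⟨pt T (x / (1 + 1 / sideLength T)) ((y + 1) / (1 + 1 / sideLength T)),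
        -(1 / sideLength T), ?_, ?_⟩
      · rw [region_down_eq, e2, e2, add_sub_cancel_right]
      · rw [dist_homothety, abs_neg, abs_of_pos (by positivity), one_div_mul_cancel hL.ne']

/-! ### The total length of the sections by a comb of horizontal lines -/

/-- The length of the section of a unit triangle at distance `u` from a side, in the direction of
the opposite vertex. -/
def sectionAt (u : ℝ) : ℝ := if 0 ≤ u then max 0 (1 - u) else 0

/-- The length of the section of a tile by the horizontal line at height `h`. -/
def Tile.section : Tile → ℝ → ℝ
  | .up _ y, h => sectionAt (h - y)
  | .down _ y, h => sectionAt (y + 1 - h)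

/-- The total length of the sections of a tile by the horizontal lines at the heights congruent to
`t` modulo `1`. The arguments of `Int.fract` are such that a side on one of these lines counts
with its length `1`. -/
def Tile.comb : Tile → ℝ → ℝ
  | .up _ y, t => 1 - Int.fract (t - y)
  | .down _ y, t => 1 - Int.fract (y - t)

/-- The height of the left end of the base of an up-triangle, or of the nadir of a
down-triangle. -/
def Tile.height : Tile → ℝ
  | .up _ y => y
  | .down _ y => y

/-- `1` for an up-triangle, `-1` for a down-triangle. -/
def Tile.sign : Tile → ℤ
  | .up _ _ => 1
  | .down _ _ => -1

lemma sectionAt_nonneg (u : ℝ) : 0 ≤ sectionAt u := by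
  unfold sectionAt
  split_ifs
  · exact le_max_left _ _
  · exact le_rfl

lemma Tile.section_nonneg (τ : Tile) (h : ℝ) : 0 ≤ τ.section h := by
  cases τ <;> exact sectionAt_nonneg _

lemma sectionAt_add_int (u : ℝ) (k : ℤ) :
    sectionAt (u + k) = if k = -⌊u⌋ then 1 - Int.fract u else 0 := by
  have h0 := Int.fract_nonneg u
  have h1 := Int.fract_lt_one u
  have hu := Int.floor_add_fract u
  split_ifs with h
  · have e : u + k = Int.fract u := by rw [h]; push_cast; linarith
    rw [e, sectionAt, if_pos h0, max_eq_right (by linarith)]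
  · unfold sectionAt
    split_ifs with h2
    · rw [max_eq_left]
      have : 0 < ⌊u⌋ + k := by
        have h3 : (-1 : ℝ) < (⌊u⌋ + k : ℤ) := by push_cast; linarith
        have h4 : -1 < ⌊u⌋ + k := by exact_mod_cast h3
        omega
      have : (1 : ℝ) ≤ (⌊u⌋ + k : ℤ) := by exact_mod_cast this
      push_cast at this
      linarith
    · rfl

lemma sum_sectionAt_le (u : ℝ) {f : ℕ → ℤ} (hf : f.Injective) (M : ℕ) :
    ∑ i ∈ Finset.range M, sectionAt (u + f i) ≤ 1 - Int.fract u := by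
  have hpos : 0 ≤ 1 - Int.fract u := by linarith [Int.fract_lt_one u]
  simp only [sectionAt_add_int]
  rw [← Finset.sum_filter, Finset.sum_const, nsmul_eq_mul]
  have hc : (Finset.filter (fun i => f i = -⌊u⌋) (Finset.range M)).card ≤ 1 := by
    refine Finset.card_le_one.2 fun a ha b hb => hf ?_
    rw [(Finset.mem_filter.1 ha).2, (Finset.mem_filter.1 hb).2]
  have hc' : ((Finset.filter (fun i => f i = -⌊u⌋) (Finset.range M)).card : ℝ) ≤ 1 := by
    exact_mod_cast hc
  nlinarith

lemma Tile.sum_section_le_comb (τ : Tile) (t : ℝ) (M : ℕ) :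
    ∑ i ∈ Finset.range M, τ.section (t + i) ≤ τ.comb t := by
  rcases τ with ⟨x, y⟩ | ⟨x, y⟩
  · have h := sum_sectionAt_le (t - y) Nat.cast_injective M
    simp only [Int.cast_natCast] at h
    refine le_of_eq_of_le (Finset.sum_congr rfl fun i _ => ?_) h
    simp only [Tile.section]
    congr 1
    ring
  · have h := sum_sectionAt_le (y - t) (f := fun i => 1 - i)
      (fun a b hab => by simpa using hab) M
    refine le_of_eq_of_le (Finset.sum_congr rfl fun i _ => ?_) h
    simp only [Tile.section]
    congr 1
    push_cast
    ring

/-- Modulo `1`, the comb of a tile is an affine function whose slope only depends on its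
orientation. -/
lemma Tile.exists_comb_eq (τ : Tile) (t : ℝ) :
    ∃ k : ℤ, τ.comb t = k + τ.sign * (τ.height - t) := by
  rcases τ with ⟨x, y⟩ | ⟨x, y⟩
  · refine ⟨1 + ⌊t - y⌋, ?_⟩
    have := Int.floor_add_fract (t - y)
    simp only [Tile.comb, Tile.sign, Tile.height]
    push_cast
    linarith
  · refine ⟨1 + ⌊y - t⌋, ?_⟩
    have := Int.floor_add_fract (y - t)
    simp only [Tile.comb, Tile.sign, Tile.height]
    push_cast
    linarith

lemma Tile.intervalIntegrable_comb (τ : Tile) (u v : ℝ) :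
    IntervalIntegrable τ.comb volume u v := by
  rcases τ with ⟨x, y⟩ | ⟨x, y⟩
  · exact intervalIntegrable_const.sub
      (intervalIntegrable_fract_comp (g := fun t => t - y) (by fun_prop) u v)
  · exact intervalIntegrable_const.sub
      (intervalIntegrable_fract_comp (g := fun t => y - t) (by fun_prop) u v)

lemma Tile.integral_comb (τ : Tile) : ∫ t in (0 : ℝ)..1, τ.comb t = 1 / 2 := by
  rcases τ with ⟨x, y⟩ | ⟨x, y⟩
  · have h := hump_add_int (0 - y) 1
    push_cast at h
    have e : ∫ t in (0 : ℝ)..1, Int.fract (t - y) = 1 / 2 := by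
      rw [intervalIntegral.integral_comp_sub_right, integral_fract,
        show 1 - y = 0 - y + 1 by ring, h]
      ring
    simp only [Tile.comb]
    rw [intervalIntegral.integral_sub intervalIntegrable_const
      (intervalIntegrable_fract_comp (g := fun t => t - y) (by fun_prop) _ _), e]
    norm_num
  · have h := hump_add_int (y - 1) 1
    push_cast at h
    have e : ∫ t in (0 : ℝ)..1, Int.fract (y - t) = 1 / 2 := by
      rw [intervalIntegral.integral_comp_sub_left, integral_fract,
        show y - 0 = y - 1 + 1 by ring, h]
      ring
    simp only [Tile.comb]
    rw [intervalIntegral.integral_sub intervalIntegrable_const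
      (intervalIntegrable_fract_comp (g := fun t => y - t) (by fun_prop) _ _), e]
    norm_num

/-! ### The lower bound -/

lemma volume_section_le (T : Affine.Triangle ℝ Plane) (τ : Tile) (h : ℝ) :
    volume {x | pt T x h ∈ τ.region T} ≤ ENNReal.ofReal (τ.section h) := by
  rcases τ with ⟨x, y⟩ | ⟨x, y⟩
  · simp only [mem_region_up, Tile.section, sectionAt]
    by_cases hy : 0 ≤ h - y
    · rw [if_pos hy]
      refine (measure_mono (t := Set.Icc x (x + y + 1 - h)) ?_).trans ?_
      · rintro a ⟨h1, -, h3⟩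
        exact ⟨h1, by linarith⟩
      · rw [Real.volume_Icc]
        exact ENNReal.ofReal_le_ofReal (le_max_of_le_right (by linarith))
    · refine le_of_eq_of_le (measure_mono_null (t := ∅) ?_ (by simp)) zero_le
      rintro a ⟨-, h2, -⟩
      exact hy (by linarith)
  · simp only [mem_region_down, Tile.section, sectionAt]
    by_cases hy : 0 ≤ y + 1 - h
    · rw [if_pos hy]
      refine (measure_mono (t := Set.Icc (x + y - h) x) ?_).trans ?_
      · rintro a ⟨h1, -, h3⟩
        exact ⟨by linarith, h1⟩
      · rw [Real.volume_Icc]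
        exact ENNReal.ofReal_le_ofReal (le_max_of_le_right (by linarith))
    · refine le_of_eq_of_le (measure_mono_null (t := ∅) ?_ (by simp)) zero_le
      rintro a ⟨-, h2, -⟩
      exact hy (by linarith)

section LowerBound

variable {T : Affine.Triangle ℝ Plane} {N : ℕ} {τ : Fin N → Tile}

lemma le_sum_section (hτ : solid T ⊆ ⋃ i, (τ i).region T) {h : ℝ} (hh : 0 ≤ h) :
    sideLength T - h ≤ ∑ i, (τ i).section h := by
  have hsub : Set.Icc 0 (sideLength T - h) ⊆ ⋃ i, {x | pt T x h ∈ (τ i).region T} := by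
    intro x hx
    have := hτ ((mem_solid T x h).2 ⟨hx.1, hh, by linarith [hx.2]⟩)
    simpa using this
  have h1 := (measure_mono (μ := volume) hsub).trans (measure_iUnion_fintype_le _ _)
  rw [Real.volume_Icc, sub_zero] at h1
  have h2 := h1.trans (Finset.sum_le_sum fun i _ => volume_section_le T (τ i) h)
  rw [← ENNReal.ofReal_sum_of_nonneg fun i _ => (τ i).section_nonneg h] at h2
  exact (ENNReal.ofReal_le_ofReal_iff
    (Finset.sum_nonneg fun i _ => (τ i).section_nonneg h)).1 h2

lemma le_sum_comb (hτ : solid T ⊆ ⋃ i, (τ i).region T) {t : ℝ} (ht : 0 ≤ t) (M : ℕ) :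
    M * (sideLength T - t) - M * (M - 1) / 2 ≤ ∑ i, (τ i).comb t := by
  have h1 : ∑ j ∈ Finset.range M, (sideLength T - (t + j)) ≤ ∑ i, (τ i).comb t := by
    refine (Finset.sum_le_sum fun (j : ℕ) _ =>
      le_sum_section hτ (h := t + j) (add_nonneg ht j.cast_nonneg)).trans ?_
    rw [Finset.sum_comm]
    exact Finset.sum_le_sum fun i _ => (τ i).sum_section_le_comb t M
  refine le_of_eq_of_le ?_ h1
  clear h1
  induction M with
  | zero => simp
  | succ m ih =>
    rw [Finset.sum_range_succ, ← ih]
    push_cast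
    ring

lemma exists_sum_comb_eq (τ : Fin N → Tile) (t : ℝ) :
    ∃ k : ℤ, ∑ i, (τ i).comb t =
      k + (∑ i, (τ i).sign * (τ i).height - ((∑ i, (τ i).sign : ℤ) : ℝ) * t) := by
  choose k hk using fun i => (τ i).exists_comb_eq t
  refine ⟨∑ i, k i, ?_⟩
  simp only [hk]
  push_cast
  rw [Finset.sum_mul, ← Finset.sum_sub_distrib, ← Finset.sum_add_distrib]
  exact Finset.sum_congr rfl fun i _ => by ring

lemma two_dvd_card_sub_sum_sign (τ : Fin N → Tile) : (2 : ℤ) ∣ N - ∑ i, (τ i).sign := by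
  have h : (N : ℤ) - ∑ i, (τ i).sign = ∑ i, (1 - (τ i).sign) := by simp
  rw [h]
  refine Finset.dvd_sum fun i _ => ?_
  cases τ i <;> simp [Tile.sign]

lemma integral_sum_comb (τ : Fin N → Tile) :
    ∫ t in (0 : ℝ)..1, ∑ i, (τ i).comb t = N / 2 := by
  rw [intervalIntegral.integral_finsetSum fun i _ => (τ i).intervalIntegrable_comb 0 1]
  simp only [Tile.integral_comb, Finset.sum_const, Finset.card_univ, Fintype.card_fin,
    nsmul_eq_mul]
  ring

lemma add_fract_le {b c x : ℝ} (hbx : b ≤ x) (k : ℤ) (h : x - b = k + c) :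
    b + Int.fract c ≤ x := by
  have h1 : Int.fract c = Int.fract (x - b) := by rw [h, Int.fract_intCast_add]
  have h2 : ((0 : ℤ) : ℝ) ≤ ⌊x - b⌋ := by
    exact_mod_cast Int.floor_nonneg.2 (sub_nonneg.2 hbx)
  have h3 := Int.self_sub_floor (x - b)
  push_cast at h2
  rw [h1, ← h3]
  linarith

lemma integral_sectionSum (L m c u v : ℝ) :
    ∫ t in u..v, (m * (L - t) - c) = (m * L - c) * (v - u) - m * (v ^ 2 - u ^ 2) / 2 := by
  have hi {f : ℝ → ℝ} (hf : Continuous f) : IntervalIntegrable f volume u v :=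
    hf.intervalIntegrable u v
  rw [intervalIntegral.integral_sub (hi (by fun_prop)) (hi (by fun_prop)),
    intervalIntegral.integral_const_mul,
    intervalIntegral.integral_sub (hi (by fun_prop)) (hi (by fun_prop))]
  simp only [intervalIntegral.integral_const, integral_id, smul_eq_mul]
  ring

/-- The number of triangles of a covering exceeds the area bound `(n + d) ^ 2` at least by twice
the integral of a fractional part. Here `s` is `n` minus the excess of up- over down-triangles. -/
lemma exists_bentFract_le {n : ℕ} {d : ℝ} (hd0 : 0 ≤ d) (hd1 : d ≤ 1)
    (hT : sideLength T = n + d) (hτ : solid T ⊆ ⋃ i, (τ i).region T) :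
    ∃ (s : ℤ) (θ : ℝ), (2 : ℤ) ∣ N - n + s ∧ (n + d) ^ 2 + 2 * bentFract s θ d ≤ N := by
  set a : ℤ := ∑ i, (τ i).sign with ha
  set Y : ℝ := ∑ i, (τ i).sign * (τ i).height with hY
  set θ : ℝ := Y - a * d - n * (n + 1) / 2 with hθ
  refine ⟨n - a, θ, ?_, ?_⟩
  · have := two_dvd_card_sub_sum_sign τ
    rw [← ha] at this
    convert this using 1
    ring
  set G : ℝ → ℝ := fun t => ∑ i, (τ i).comb t with hG
  have hGi (u v : ℝ) : IntervalIntegrable G volume u v := by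
    simpa only [Finset.sum_fn] using IntervalIntegrable.sum Finset.univ fun i _ =>
      (τ i).intervalIntegrable_comb u v
  -- lines at height `t ≤ d` modulo `1` meet the triangle `n + 1` times
  have h1 : ∀ t ∈ Set.Icc 0 d, ((n + 1 : ℝ) * (sideLength T - t) - (n + 1) * n / 2) +
      Int.fract (θ + (((n - a : ℤ) : ℝ) + 1) * (t - d)) ≤ G t := by
    intro t ht
    obtain ⟨k, hk⟩ := exists_sum_comb_eq τ t
    have h := le_sum_comb hτ ht.1 (n + 1)
    push_cast at h
    refine add_fract_le (by simpa using h) k ?_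
    simp only [hG, hk, ← ha, ← hY, hθ, hT]
    push_cast
    ring
  -- the other lines meet it `n` times
  have h2 : ∀ t ∈ Set.Icc d 1, ((n : ℝ) * (sideLength T - t) - n * (n - 1) / 2) +
      Int.fract (θ + ((n - a : ℤ) : ℝ) * (t - d)) ≤ G t := by
    intro t ht
    obtain ⟨k, hk⟩ := exists_sum_comb_eq τ t
    refine add_fract_le (le_sum_comb hτ (hd0.trans ht.1) n) k ?_
    simp only [hG, hk, ← ha, ← hY, hθ, hT]
    push_cast
    ring
  have hf (m : ℝ) (u v : ℝ) : IntervalIntegrable (fun t => Int.fract (θ + m * (t - d)))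
      volume u v := intervalIntegrable_fract_comp (by fun_prop) u v
  have hl (m c : ℝ) (u v : ℝ) : IntervalIntegrable (fun t => m * (sideLength T - t) - c)
      volume u v := Continuous.intervalIntegrable (by fun_prop) u v
  have i1 := intervalIntegral.integral_mono_on hd0 ((hl _ _ _ _).add (hf _ _ _)) (hGi 0 d) h1
  have i2 := intervalIntegral.integral_mono_on hd1 ((hl _ _ _ _).add (hf _ _ _)) (hGi d 1) h2
  rw [intervalIntegral.integral_add (hl _ _ _ _) (hf _ _ _), integral_sectionSum, hT] at i1 i2
  have i3 := intervalIntegral.integral_add_adjacent_intervals (hGi 0 d) (hGi d 1)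
  rw [hG, integral_sum_comb, ← hG] at i3
  unfold bentFract
  linarith

/-- The two lower bounds, of which the parity of the number of triangles selects one. -/
lemma card_ge {n : ℕ} {d : ℝ} (hd0 : 0 ≤ d) (hd1 : d ≤ 1)
    (hT : sideLength T = n + d) (hτ : solid T ⊆ ⋃ i, (τ i).region T) :
    ((2 : ℤ) ∣ N - n ∧ n ^ 2 + 2 * ((n + 1) * d) ≤ N) ∨
      ((2 : ℤ) ∣ N - n - 1 ∧ n ^ 2 + 2 * (n * d) + 1 ≤ N) := by
  obtain ⟨s, θ, hs, h⟩ := exists_bentFract_le hd0 hd1 hT hτ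
  rcases Int.even_or_odd' s with ⟨c, rfl | rfl⟩
  · refine Or.inl ⟨by omega, ?_⟩
    by_cases hc : 2 * c = 0
    · rw [hc, Int.cast_zero] at h
      linarith [le_bentFract_zero θ d]
    · have := le_bentFract hc (by omega) θ d 1
      push_cast at this h
      linarith
  · refine Or.inr ⟨by omega, ?_⟩
    by_cases hc : 2 * c + 1 = -1
    · rw [hc, Int.cast_neg, Int.cast_one] at h
      linarith [le_bentFract_neg_one θ d]
    · have := le_bentFract (by omega) hc θ d 0
      push_cast at this h
      linarith

end LowerBound

/-! ### The covering -/

/-- Some tile of the list contains the point with skew coordinates `(a, b)`. -/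
def Covers (l : List Tile) (T : Affine.Triangle ℝ Plane) (a b : ℝ) : Prop :=
  ∃ τ ∈ l, pt T a b ∈ τ.region T

lemma length_row (a b : ℕ) (s y : ℝ) : (row a b s y).length = a + b := by
  simp [row]

/-- A slid row covers a trapezoid of height `1 + s`. -/
lemma covers_row (T : Affine.Triangle ℝ Plane) (m : ℕ) {s y a b : ℝ} (hs : s < 1) (ha : 0 ≤ a)
    (hb : y ≤ b) (hb' : b ≤ y + 1 + s) (hab : a + b ≤ y + 1 + m * (1 - s)) :
    Covers (row (m + 1) m s y) T a b := by
  have hs' : 0 < 1 - s := by linarith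
  have h1 : ⌊a / (1 - s)⌋₊ * (1 - s) ≤ a :=
    (le_div_iff₀ hs').1 (Nat.floor_le (by positivity))
  have h2 : a < (⌊a / (1 - s)⌋₊ + 1) * (1 - s) :=
    (div_lt_iff₀ hs').1 (Nat.lt_floor_add_one _)
  set i := ⌊a / (1 - s)⌋₊
  rcases le_or_gt m i with hi | hi
  · -- to the right of the left corner of the last up-triangle
    have h3 : (m : ℝ) * (1 - s) ≤ i * (1 - s) :=
      mul_le_mul_of_nonneg_right (by exact_mod_cast hi) hs'.le
    refine ⟨.up (m * (1 - s)) y, ?_, ?_⟩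
    · simp only [row, List.mem_append, List.mem_map, List.mem_range]
      exact Or.inl ⟨m, by omega, rfl⟩
    · rw [mem_region_up]
      exact ⟨by linarith, hb, by linarith⟩
  · rcases le_or_gt (a + b) (i * (1 - s) + y + 1) with h | h
    · refine ⟨.up (i * (1 - s)) y, ?_, ?_⟩
      · simp only [row, List.mem_append, List.mem_map, List.mem_range]
        exact Or.inl ⟨i, by omega, rfl⟩
      · rw [mem_region_up]
        exact ⟨h1, hb, h⟩
    · refine ⟨.down ((i + 1) * (1 - s)) (y + s), ?_, ?_⟩
      · simp only [row, List.mem_append, List.mem_map, List.mem_range]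
        exact Or.inr ⟨i, hi, rfl⟩
      · rw [mem_region_down]
        exact ⟨h2.le, by linarith, by linarith⟩

lemma exists_step {f : ℕ → ℝ} {x : ℝ} (n : ℕ) (h0 : f 0 ≤ x) (hn : x ≤ f n) (hpos : 0 < n) :
    ∃ k < n, f k ≤ x ∧ x ≤ f (k + 1) := by
  induction n with
  | zero => omega
  | succ m ih =>
    by_cases h : f m ≤ x
    · exact ⟨m, by omega, h, hn⟩
    · rcases m.eq_zero_or_pos with rfl | hm
      · exact absurd h0 h
      · obtain ⟨k, hk, h'⟩ := ih (not_le.1 h).le hm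
        exact ⟨k, by omega, h'⟩

lemma evenSlide_of_le {j k : ℕ} (h : j ≤ k) : evenSlide j k = j / (k * (k + 1)) := if_pos h

lemma evenSlide_of_lt {j k : ℕ} (h : k < j) : evenSlide j k = 0 := if_neg h.not_ge

lemma oddSlide_of_le {j k : ℕ} (h : j ≤ k) : oddSlide j k = (j - 1) / (k * (k - 1)) := if_pos h

lemma oddSlide_of_lt {j k : ℕ} (h : k < j) : oddSlide j k = 0 := if_neg h.not_ge

lemma evenDepth_succ (j k : ℕ) : evenDepth j (k + 1) = evenDepth j k + 1 + evenSlide j (k + 1) := by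
  unfold evenDepth
  rcases le_or_gt j (k + 1) with h | h
  · rw [Finset.sum_Icc_succ_top h]
    push_cast
    ring
  · rw [Finset.Icc_eq_empty_of_lt h, Finset.Icc_eq_empty_of_lt (by omega), evenSlide_of_lt h]
    push_cast
    simp

lemma evenDepth_of_lt {j k : ℕ} (h : k < j) : evenDepth j k = k := by
  simp [evenDepth, Finset.Icc_eq_empty_of_lt h]

/-- The sum of the slide values telescopes. -/
lemma evenDepth_of_le {j k : ℕ} (hj : 1 ≤ j) (h : j ≤ k) :
    evenDepth j k = k + 1 - j / (k + 1) := by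
  induction k, h using Nat.le_induction with
  | base =>
    have : (j : ℝ) ≠ 0 := by positivity
    have : (j + 1 : ℝ) ≠ 0 := by positivity
    simp only [evenDepth, Finset.Icc_self, Finset.sum_singleton, evenSlide_of_le le_rfl]
    field_simp
    ring
  | succ k hk ih =>
    rw [evenDepth_succ, ih, evenSlide_of_le (by omega)]
    push_cast
    field_simp
    ring

lemma oddDepth_succ (j k : ℕ) : oddDepth j (k + 1) = oddDepth j k + 1 - oddSlide j (k + 1) := by
  unfold oddDepth
  rcases le_or_gt j (k + 1) with h | h
  · rw [Finset.sum_Icc_succ_top h]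
    push_cast
    ring
  · rw [Finset.Icc_eq_empty_of_lt h, Finset.Icc_eq_empty_of_lt (by omega), oddSlide_of_lt h]
    push_cast
    simp

lemma oddDepth_of_lt {j k : ℕ} (h : k < j) : oddDepth j k = k + 1 := by
  simp [oddDepth, Finset.Icc_eq_empty_of_lt h]

/-- The sum of the slide values telescopes. It starts at `k = j - 1`, where it is empty. -/
lemma oddDepth_of_le {j k : ℕ} (hj : 2 ≤ j) (h : j - 1 ≤ k) :
    oddDepth j k = k + (j - 1) / k := by
  induction k, h using Nat.le_induction with
  | base =>
    obtain ⟨i, rfl⟩ : ∃ i, j = i + 2 := ⟨j - 2, by omega⟩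
    rw [oddDepth_of_lt (by omega)]
    simp only [Nat.add_succ_sub_one]
    push_cast
    rw [show (i : ℝ) + 2 - 1 = i + 1 by ring, div_self (by positivity)]
  | succ k hk ih =>
    have : (k : ℝ) ≠ 0 := by
      have : k ≠ 0 := by omega
      exact_mod_cast this
    rw [oddDepth_succ, ih, oddSlide_of_le (by omega)]
    push_cast
    rw [add_sub_cancel_right]
    field_simp
    ring

lemma covers_basicEven (T : Affine.Triangle ℝ Plane) {n j : ℕ} (hj : 1 ≤ j) (hjn : j ≤ n)
    {a b : ℝ} (ha : 0 ≤ a) (hb : 0 ≤ b) (hab : a + b ≤ evenDepth j n) :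
    Covers (basicEven n j) T a b := by
  obtain ⟨k, hk, h1, h2⟩ := exists_step (f := evenDepth j) (x := evenDepth j n - b) n
    (by rw [evenDepth_of_lt (by omega)]; push_cast; linarith) (by linarith) (by omega)
  suffices h : Covers (if j ≤ k + 1 then
      row (k + 1 + 1) (k + 1) (evenSlide j (k + 1)) (evenDepth j n - evenDepth j (k + 1))
      else row (k + 1) k 0 (evenDepth j n - evenDepth j (k + 1))) T a b by
    obtain ⟨τ, hτ, hm⟩ := h
    refine ⟨τ, List.mem_flatMap.2 ⟨k + 1, ?_, hτ⟩, hm⟩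
    simp only [List.mem_range'_1]
    omega
  have h3 := evenDepth_succ j k
  split_ifs with h
  · have h4 := evenDepth_of_le hj h
    have h5 := evenSlide_of_le h
    have hlt : evenSlide j (k + 1) < 1 := by
      rw [h5, div_lt_one (by positivity)]
      have : (j : ℝ) ≤ (k + 1 : ℕ) := by exact_mod_cast h
      push_cast at this ⊢
      nlinarith
    have e : ((k + 1 : ℕ) : ℝ) * (1 - evenSlide j (k + 1)) = evenDepth j (k + 1) - 1 := by
      rw [h4, h5]
      push_cast
      field_simp
      ring
    exact covers_row T (k + 1) hlt ha (by linarith) (by linarith) (by rw [e]; linarith)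
  · have h4 := evenDepth_of_lt (not_le.1 h)
    have h5 := evenSlide_of_lt (not_le.1 h)
    push_cast at h4
    exact covers_row T k one_pos ha (by linarith) (by linarith) (by linarith)

lemma covers_basicOdd (T : Affine.Triangle ℝ Plane) {n j : ℕ} (hn : 1 ≤ n) (hj : 2 ≤ j)
    {a b : ℝ} (ha : 0 ≤ a) (hb : 0 ≤ b) (hab : a + b ≤ oddDepth j n) :
    Covers (basicOdd n j) T a b := by
  rcases le_or_gt (oddDepth j n - 1) b with hb1 | hb1
  · refine ⟨.up 0 (oddDepth j n - 1), List.mem_cons_self, ?_⟩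
    rw [mem_region_up]
    exact ⟨ha, hb1, by linarith⟩
  obtain ⟨k, hk, h1, h2⟩ := exists_step (f := oddDepth j) (x := oddDepth j n - b) n
    (by rw [oddDepth_of_lt (by omega)]; push_cast; linarith) (by linarith) (by omega)
  suffices h : Covers (if j ≤ k + 1 then
      row (k + 1) k (-oddSlide j (k + 1)) (oddDepth j n - oddDepth j (k + 1))
      else row (k + 1 + 1) (k + 1) 0 (oddDepth j n - oddDepth j (k + 1))) T a b by
    obtain ⟨τ, hτ, hm⟩ := h
    refine ⟨τ, List.mem_cons_of_mem _ (List.mem_flatMap.2 ⟨k + 1, ?_, hτ⟩), hm⟩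
    simp only [List.mem_range'_1]
    omega
  have h3 := oddDepth_succ j k
  split_ifs with h
  · have h4 := oddDepth_of_le hj (show j - 1 ≤ k + 1 by omega)
    have h5 := oddSlide_of_le h
    have hk0 : (0 : ℝ) < k := by
      have : 0 < k := by omega
      exact_mod_cast this
    have hlt : -oddSlide j (k + 1) < 1 := by
      have : (2 : ℝ) ≤ j := by exact_mod_cast hj
      have : 0 ≤ oddSlide j (k + 1) := by
        rw [h5]
        push_cast
        rw [add_sub_cancel_right]
        exact div_nonneg (by linarith) (by positivity)
      linarith
    have e : (k : ℝ) * (1 - -oddSlide j (k + 1)) = oddDepth j (k + 1) - 1 := by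
      rw [h4, h5]
      push_cast
      rw [add_sub_cancel_right]
      field_simp
      ring
    exact covers_row T k hlt ha (by linarith) (by linarith) (by rw [e]; linarith)
  · have h4 := oddDepth_of_lt (not_le.1 h)
    have h5 := oddSlide_of_lt (not_le.1 h)
    push_cast at h4
    exact covers_row T (k + 1) one_pos ha (by linarith) (by linarith)
      (by push_cast; linarith)

lemma sum_length_even_rows {j : ℕ} (hj : 1 ≤ j) (n : ℕ) :
    ((List.range' 1 n).map fun k => if j ≤ k then k + 1 + k else k + (k - 1)).sum =
      n ^ 2 + 2 * (n + 1 - j) := by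
  induction n with
  | zero => simp; omega
  | succ n ih =>
    rw [List.range'_1_concat, List.map_append, List.sum_append, ih]
    simp only [List.map_cons, List.map_nil, List.sum_cons, List.sum_nil]
    rw [show (n + 1) ^ 2 = n ^ 2 + 2 * n + 1 by ring]
    split_ifs <;> omega

lemma sum_length_odd_rows {j : ℕ} (hj : 2 ≤ j) (n : ℕ) :
    ((List.range' 1 n).map fun k => if j ≤ k then k + (k - 1) else k + 1 + k).sum =
      n ^ 2 + 2 * min n (j - 1) := by
  induction n with
  | zero => simp
  | succ n ih =>
    rw [List.range'_1_concat, List.map_append, List.sum_append, ih]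
    simp only [List.map_cons, List.map_nil, List.sum_cons, List.sum_nil]
    rw [show (n + 1) ^ 2 = n ^ 2 + 2 * n + 1 by ring]
    split_ifs <;> omega

lemma length_basicEven {n j : ℕ} (hj : 1 ≤ j) :
    (basicEven n j).length = n ^ 2 + 2 * (n + 1 - j) := by
  rw [← sum_length_even_rows hj, basicEven, List.length_flatMap]
  simp only [apply_ite List.length, length_row]

lemma length_basicOdd {n j : ℕ} (hj : 2 ≤ j) (hjn : j ≤ n + 1) :
    (basicOdd n j).length = n ^ 2 + 2 * (j - 1) + 1 := by
  have h := sum_length_odd_rows hj n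
  rw [min_eq_right (by omega)] at h
  rw [← h, basicOdd, List.length_cons, List.length_flatMap]
  simp only [apply_ite List.length, length_row]

/-! ### The consolidated method -/

section Consolidated

variable {n : ℕ} {d : ℝ}

lemma jEven_le (hd0 : 0 < d) : jEven n d ≤ n := by
  have : (1 - d) * ((n : ℝ) + 1) < n + 1 := by
    have : (0 : ℝ) < n + 1 := by positivity
    nlinarith
  exact Nat.lt_succ_iff.1 ((Nat.floor_lt' (by omega)).2 (by push_cast; exact this))

lemma two_le_jOdd (hn : 1 ≤ n) (hd0 : 0 < d) : 2 ≤ jOdd n d := by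
  have : (1 : ℝ) ≤ n := by exact_mod_cast hn
  exact Nat.lt_ceil.2 (by push_cast; nlinarith)

lemma jOdd_le (hd1 : d < 1) : jOdd n d ≤ n + 1 := by
  refine Nat.ceil_le.2 ?_
  push_cast
  have : (0 : ℝ) ≤ n := by positivity
  nlinarith

lemma pOdd_le_iff (q : ℕ) : pOdd n d ≤ q ↔ n * d ≤ q := by
  rw [pOdd, tsub_le_iff_right, jOdd, Nat.ceil_le]
  push_cast
  rw [add_le_add_iff_right, mul_comm]

lemma pEven_le_iff (hd0 : 0 < d) (hd1 : d < 1) (q : ℕ) :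
    pEven n d ≤ q ↔ (n + 1) * d ≤ q := by
  have hj := jEven_le (n := n) hd0
  have h0 : 0 ≤ (1 - d) * ((n : ℝ) + 1) := mul_nonneg (by linarith) (by positivity)
  rcases le_or_gt (n + 1) q with h | h
  · have : (n : ℝ) + 1 ≤ q := by exact_mod_cast h
    refine iff_of_true (by unfold pEven; omega) ?_
    nlinarith
  · have e : pEven n d ≤ q ↔ n + 1 - q ≤ jEven n d := by unfold pEven; omega
    rw [e, jEven, Nat.le_floor_iff h0, Nat.cast_sub h.le]
    push_cast
    constructor <;> intro <;> linarith

/-- If `jEven n d = 0`, then `pEven n d = n + 1` exceeds `pOdd n d ≤ n`: the consolidated method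
never places the standard covering of the even method. -/
lemma one_le_jEven (hd1 : d < 1) (h : ¬ pOdd n d < pEven n d) :
    1 ≤ jEven n d := by
  have := jOdd_le (n := n) hd1
  unfold pOdd pEven at h
  omega

lemma length_fullTiles (hn : 1 ≤ n) (hd0 : 0 < d) (hd1 : d < 1) :
    (fullTiles n d).length = if pOdd n d < pEven n d
      then n ^ 2 + 2 * pOdd n d + 1 else n ^ 2 + 2 * pEven n d := by
  unfold fullTiles
  split_ifs with h
  · exact length_basicOdd (two_le_jOdd hn hd0) (jOdd_le hd1)
  · have hj := one_le_jEven hd1 h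
    have hj' := jEven_le (n := n) hd0
    rw [fullEven, if_neg (by omega), length_basicEven hj, pEven]
    omega

lemma covers_fullTiles (T : Affine.Triangle ℝ Plane) (hn : 1 ≤ n) (hd0 : 0 < d) (hd1 : d < 1)
    {a b : ℝ} (ha : 0 ≤ a) (hb : 0 ≤ b) (hab : a + b ≤ n + d) :
    Covers (fullTiles n d) T a b := by
  unfold fullTiles
  split_ifs with h
  · have hj := two_le_jOdd hn hd0
    have hj' := jOdd_le (n := n) hd1
    refine covers_basicOdd T hn hj ha hb (hab.trans ?_)
    rw [oddDepth_of_le hj (by omega)]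
    have hn' : (0 : ℝ) < n := by exact_mod_cast hn
    rw [add_le_add_iff_left, le_div_iff₀ hn', le_sub_iff_add_le]
    exact Nat.le_ceil _
  · have hj := one_le_jEven hd1 h
    rw [fullEven, if_neg (by omega)]
    refine covers_basicEven T hj (jEven_le hd0) ha hb (hab.trans ?_)
    rw [evenDepth_of_le hj (jEven_le hd0), add_sub_assoc, add_le_add_iff_left, le_sub_comm,
      div_le_iff₀ (by positivity)]
    exact Nat.floor_le (mul_nonneg (by linarith) (by positivity))

end Consolidated

end TriangleCover

end

theorem theorem11 (n : ℕ) (hn : 1 ≤ n) (d : ℝ) (hd0 : 0 < d) (hd1 : d < 1)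
    (T : Affine.Triangle ℝ TriangleCover.Plane)
    (hT : TriangleCover.sideLength T = (n : ℝ) + d) :
    -- the method places homothetic unit triangles only
    (∀ S ∈ TriangleCover.coverTriangleFull n d T, TriangleCover.IsHomotheticUnit T S) ∧
    -- they cover the given triangle
    (TriangleCover.solid T ⊆ ⋃ S ∈ TriangleCover.coverTriangleFull n d T, S) ∧
    -- how many it places
    (TriangleCover.coverTriangleFull n d T).length =
      (if TriangleCover.pOdd n d < TriangleCover.pEven n d
        then n ^ 2 + 2 * TriangleCover.pOdd n d + 1
        else n ^ 2 + 2 * TriangleCover.pEven n d) ∧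
    -- no covering by homothetic unit triangles has fewer
    (∀ (N : ℕ) (S : Fin N → Set TriangleCover.Plane),
      (∀ i, TriangleCover.IsHomotheticUnit T (S i)) →
      TriangleCover.solid T ⊆ ⋃ i, S i →
      (TriangleCover.coverTriangleFull n d T).length ≤ N) := by
  open TriangleCover in
  have hL : 1 < sideLength T := by
    have : (1 : ℝ) ≤ n := by exact_mod_cast hn
    linarith
  have hlen : (coverTriangleFull n d T).length = if pOdd n d < pEven n d
      then n ^ 2 + 2 * pOdd n d + 1 else n ^ 2 + 2 * pEven n d := by
    rw [coverTriangleFull, List.length_map, length_fullTiles hn hd0 hd1]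
  refine ⟨fun S hS => ?_, fun p hp => ?_, hlen, fun N S hS hcov => ?_⟩
  · obtain ⟨τ, -, rfl⟩ := List.mem_map.1 hS
    exact (isHomotheticUnit_iff hL _).2 ⟨τ, rfl⟩
  · obtain ⟨a, b, rfl⟩ := exists_eq_pt T p
    obtain ⟨ha, hb, hab⟩ := (mem_solid T a b).1 hp
    obtain ⟨τ, hτ, hm⟩ := covers_fullTiles T hn hd0 hd1 ha hb (hT ▸ hab)
    exact Set.mem_biUnion (List.mem_map_of_mem hτ) hm
  · -- coverings with the parity of `n` are compared to the even method, the others to the odd one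
    choose τ hτ using fun i => (isHomotheticUnit_iff hL _).1 (hS i)
    obtain rfl : S = fun i => (τ i).region T := funext hτ
    rw [hlen]
    rcases card_ge hd0.le hd1.le hT hcov with ⟨h2, h⟩ | ⟨h2, h⟩
    all_goals
      have hnd : 0 ≤ n * d := by positivity
      have hN : n ^ 2 ≤ N := by
        have : (n : ℝ) ^ 2 ≤ N := by linarith
        exact_mod_cast this
      -- `n ^ 2` and `n` have the same parity
      have hsq : (2 : ℤ) ∣ n ^ 2 - n := by
        rw [pow_two, ← mul_sub_one]
        exact (Int.even_mul_pred_self n).two_dvd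
      obtain ⟨e, rfl⟩ := Nat.exists_eq_add_of_le hN
      push_cast at h h2
    · obtain ⟨q, rfl⟩ : ∃ q : ℕ, e = 2 * q := ⟨e / 2, by omega⟩
      have : pEven n d ≤ q := by
        rw [pEven_le_iff hd0 hd1]
        push_cast at h
        linarith
      split_ifs <;> omega
    · obtain ⟨q, rfl⟩ : ∃ q : ℕ, e = 2 * q + 1 := ⟨e / 2, by omega⟩
      have : pOdd n d ≤ q := by
        rw [pOdd_le_iff]
        push_cast at h
        linarith
      split_ifs <;> omega
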